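/- Let $k>1$ and $q>2$ be integers, let $\zeta_q=e^{2\pi i/q}$, and let $\mathbb{K}\subset\mathbb{C}$ be a number field with $\mathbb{K}\cap\mathbb{Q}(\zeta_q)=\mathbb{Q}$. For real $0<x\le 1$ put $\zeta(k,x)=\sum_{n=0}^{\infty}\frac{1}{(n+x)^k}$, and let $\widehat{V}_k(q,\mathbb{K})$ be the $\mathbb{K}$-linear subspace of $\mathbb{C}$ generated by $1$ and the numbers $\zeta(k,a/q)$ for $1\le a<q$ with $\gcd(a,q)=1$. Then $$\dim_{\mathbb{K}}\widehat{V}_k(q,\mathbb{K})\ \ge\ \frac{\varphi(q)}{2}+1,$$ where $\varphi$ is Euler's totient function. -/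

import Mathlib

noncomputable section

namespace Milnor

/-- The `q`-th cyclotomic field `ℚ(ζ_q)`, with `ζ_q = exp(2πi/q)`, as a subfield of `ℂ`. -/
def cyclotomicSubfield (q : ℕ) : IntermediateField ℚ ℂ :=
  IntermediateField.adjoin ℚ {Complex.exp (2 * Real.pi * Complex.I / q)}

/-- The Hurwitz zeta value `ζ(k, a/q)`, as a complex number. For `1 < k` and `0 < a < q` it is the
sum of the series `∑ n ≥ 0, 1 / (n + a/q)^k`. -/
def zetaValue (k q a : ℕ) : ℂ :=
  HurwitzZeta.hurwitzZeta (((a : ℝ) / (q : ℝ) : ℝ) : UnitAddCircle) (k : ℂ)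

/-- The `K`-linear subspace of `ℂ` generated by `1` and the values `ζ(k, a/q)` for
`1 ≤ a < q`, `(a, q) = 1`. -/
def extendedSpace (k q : ℕ) (K : IntermediateField ℚ ℂ) : Submodule K ℂ :=
  Submodule.span K
    (insert 1 {z : ℂ | ∃ a : ℕ, 1 ≤ a ∧ a < q ∧ Nat.Coprime a q ∧ z = zetaValue k q a})

end Milnor

end

/-! The values `ζ(k, a/q) + (-1)^k ζ(k, 1 - a/q)`, for reduced `a < q/2`, lie in the space together
with `1`, and there are at least `φ(q)/2` of them. It suffices that all these numbers are linearly
independent over `K`. A relation reads `c + ∑ f(a) ζ(k, a/q) = 0` with `f` a `K`-valued function on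
residues, supported on units, of parity `(-1)^k`. By the Fourier series of Bernoulli polynomials,
the sum is `π^k` times an algebraic multiple of an algebraic number `S`. As `π` is transcendental
(`transcendental_pi`), `S = 0` and hence `c = 0`. Now `S` is a polynomial over `K` in `ζ_q`. Since
`K ∩ ℚ(ζ_q) = ℚ`, its vanishing survives `ζ_q ↦ ζ_q^h`
(`aeval_pow_eq_zero_of_inf_cyclotomicSubfield_eq_bot`), so `∑ f(un)/n^k = 0` for every unit `u`. If
`|f|` is maximal at `u`, the first term outweighs the rest because `ζ(2) - 1 < 1`
(`eq_zero_of_hasSum_div_pow_eq_zero`), so `f = 0`. -/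

/-! ### Transcendence of `π`. -/

open Polynomial in
/-- Multiplying by a high enough power of `a` clears the denominators of an integer polynomial
evaluated at `x`, if `a * x` is integral. -/
theorem isIntegral_pow_mul_aeval {L : Type*} [Field L] {a : ℤ} {x : L}
    (hx : IsIntegral ℤ ((a : L) * x)) (g : ℤ[X]) {M : ℕ} (hM : g.natDegree ≤ M) :
    IsIntegral ℤ ((a : L) ^ M * aeval x g) := by
  rw [aeval_eq_sum_range' (Nat.lt_succ_of_le hM), Finset.mul_sum]
  refine IsIntegral.sum _ fun i hi => ?_
  have hi' : i ≤ M := Nat.lt_succ_iff.mp (Finset.mem_range.mp hi)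
  have h : (a : L) ^ M * g.coeff i • x ^ i =
      ((a ^ (M - i) * g.coeff i : ℤ) : L) * ((a : L) * x) ^ i := by
    rw [zsmul_eq_mul, mul_pow]
    push_cast
    rw [← Nat.sub_add_cancel hi', pow_add]
    simp only [Nat.add_sub_cancel]
    ring
  rw [h]
  exact (isIntegral_algebraMap (R := ℤ) (A := L) (x := a ^ (M - i) * g.coeff i)).mul (hx.pow i)

/-- An integral element of a Galois extension of `ℚ` that is fixed by all automorphisms is an
integer. -/
theorem exists_intCast_eq_of_isIntegral_of_fixed {L : Type*} [Field L] [Algebra ℚ L] [IsGalois ℚ L]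
    {y : L} (hy : IsIntegral ℤ y) (hfix : ∀ σ : Gal(L/ℚ), σ y = y) : ∃ z : ℤ, (z : L) = y := by
  obtain ⟨r, rfl⟩ := (InfiniteGalois.mem_range_algebraMap_iff_fixed y).mpr hfix
  have hr : IsIntegral ℤ r :=
    (isIntegral_algebraMap_iff (algebraMap ℚ L).injective).mp hy
  obtain ⟨z, rfl⟩ := IsIntegrallyClosed.isIntegral_iff.mp hr
  exact ⟨z, by simp⟩

open Polynomial in
/-- A Galois-stable finite family of nonzero elements is annihilated by an integer polynomial
whose complex roots are exactly the images of the family. -/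
theorem exists_int_polynomial_of_galois_stable {L ι : Type*} [Field L] [Algebra ℚ L]
    [IsGalois ℚ L] (T : Finset ι) (v : ι → L) (hv : ∀ i ∈ T, v i ≠ 0)
    (hstable : ∀ σ : Gal(L/ℚ), ∃ e : Equiv.Perm ι,
      (∀ i, i ∈ T ↔ e i ∈ T) ∧ ∀ i ∈ T, σ (v i) = v (e i)) :
    ∃ G : ℤ[X], G.eval 0 ≠ 0 ∧ ∀ i ∈ T, aeval (v i) G = 0 := by
  set Q : L[X] := ∏ i ∈ T, (X - C (v i)) with hQ
  -- Automorphisms only permute the linear factors, so the coefficients of `Q` are rational.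
  have hfix : ∀ σ : Gal(L/ℚ), Q.map (σ : L →+* L) = Q := by
    intro σ
    obtain ⟨e, he, hev⟩ := hstable σ
    rw [hQ, Polynomial.map_prod]
    exact Finset.prod_equiv e he fun i hi => by simp [hev i hi]
  have hlift : Q ∈ lifts (algebraMap ℚ L) := by
    rw [lifts_iff_coeff_lifts]
    intro n
    rw [InfiniteGalois.mem_range_algebraMap_iff_fixed]
    intro σ
    have := congrArg (fun P => P.coeff n) (hfix σ)
    simpa [coeff_map] using this
  obtain ⟨Q₀, hQ₀⟩ := (mem_lifts _).mp hlift
  obtain ⟨b, hb, hG⟩ := IsLocalization.integerNormalization_spec (nonZeroDivisors ℤ) Q₀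
  set G := IsLocalization.integerNormalization (nonZeroDivisors ℤ) Q₀
  have hb0 : b ≠ 0 := nonZeroDivisors.ne_zero hb
  have hGQ : G.map (algebraMap ℤ L) = C (b : L) * Q := by
    rw [IsScalarTower.algebraMap_eq ℤ ℚ L, ← Polynomial.map_map, hG, ← hQ₀]
    ext n
    simp
  have hL : CharZero L := charZero_of_injective_algebraMap (algebraMap ℚ L).injective
  refine ⟨G, fun h0 => ?_, fun i hi => ?_⟩
  · have h1 : (G.map (algebraMap ℤ L)).eval 0 = 0 := by
      rw [← coeff_zero_eq_eval_zero, coeff_map, coeff_zero_eq_eval_zero, h0, map_zero]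
    rw [hGQ, eval_mul, eval_C, hQ, eval_prod] at h1
    rcases mul_eq_zero.mp h1 with h | h
    · exact hb0 (by exact_mod_cast h)
    · obtain ⟨i, hi, h⟩ := Finset.prod_eq_zero_iff.mp h
      exact hv i hi (by simpa using h)
  · rw [aeval_def, ← eval_map, hGQ, eval_mul, hQ, eval_prod,
      Finset.prod_eq_zero hi (by simp), mul_zero]

open Filter Topology in
theorem tendsto_pow_div_factorial_pred (c : ℝ) :
    Tendsto (fun p : ℕ => c ^ p / ((p - 1).factorial : ℝ)) atTop (𝓝 0) := by
  rw [← tendsto_add_atTop_iff_nat 1]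
  have h := (FloorSemiring.tendsto_pow_div_factorial_atTop c).const_mul c
  rw [mul_zero] at h
  refine h.congr fun p => ?_
  rw [Nat.add_sub_cancel, pow_succ']
  ring

open Polynomial Filter in
/-- The Lindemann–Weierstrass argument for a Galois-stable family of nonzero algebraic
exponents. -/
theorem add_sum_exp_ne_zero_of_galois_stable {L ι : Type*} [Field L] [Algebra ℚ L]
    [IsGalois ℚ L] (φ : L →ₐ[ℚ] ℂ) (T : Finset ι) (v : ι → L) (hv : ∀ i ∈ T, v i ≠ 0)
    (hstable : ∀ σ : Gal(L/ℚ), ∃ e : Equiv.Perm ι,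
      (∀ i, i ∈ T ↔ e i ∈ T) ∧ ∀ i ∈ T, σ (v i) = v (e i))
    {m : ℤ} (hm : m ≠ 0) : (m : ℂ) + ∑ i ∈ T, Complex.exp (φ (v i)) ≠ 0 := by
  intro hsum
  obtain ⟨G, hG0, hGv⟩ := exists_int_polynomial_of_galois_stable T v hv hstable
  have hGne : G ≠ 0 := by rintro rfl; simp at hG0
  obtain ⟨c, hc⟩ := LindemannWeierstrass.exp_polynomial_approx G hG0
  set a := G.leadingCoeff with ha
  have ha0 : a ≠ 0 := leadingCoeff_ne_zero.mpr hGne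
  set N := G.natDegree with hN
  have hlim := (tendsto_pow_div_factorial_pred ((|(a : ℝ)|) ^ N * c)).const_mul (T.card : ℝ)
  rw [mul_zero] at hlim
  obtain ⟨p₀, hp₀⟩ := eventually_atTop.mp (hlim.eventually (gt_mem_nhds one_pos))
  -- Such a prime divides neither `a` nor `m`, satisfies the size condition involving `G(0)` in the
  -- approximation, and makes the error less than 1.
  obtain ⟨p, hp, hprime⟩ := Nat.exists_infinite_primes
    (p₀ + (eval 0 G).natAbs + a.natAbs + m.natAbs + 1)
  obtain ⟨n, hn, g, hgdeg, hg⟩ := hc p (by omega) hprime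
  have hint : ∃ z : ℤ, (z : L) = ∑ i ∈ T, (a : L) ^ (p * N) * aeval (v i) g := by
    refine exists_intCast_eq_of_isIntegral_of_fixed (IsIntegral.sum _ fun i hi => ?_) fun σ => ?_
    · refine isIntegral_pow_mul_aeval ?_ g (by omega)
      have := isIntegral_leadingCoeff_smul G (v i) (hGv i hi)
      rwa [zsmul_eq_mul] at this
    · obtain ⟨e, he, hev⟩ := hstable σ
      rw [map_sum]
      refine Finset.sum_equiv e he fun i hi => ?_
      rw [map_mul, map_pow, map_intCast, ← hev i hi]
      congr 1
      exact (aeval_algHom_apply ((σ : L →ₐ[ℚ] L).restrictScalars ℤ) (v i) g).symm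
  obtain ⟨z, hz⟩ := hint
  have hz' : (z : ℂ) = ∑ i ∈ T, (a : ℂ) ^ (p * N) * aeval (φ (v i)) g := by
    have := congrArg φ hz
    rw [map_intCast, map_sum] at this
    rw [this]
    refine Finset.sum_congr rfl fun i _ => ?_
    rw [map_mul, map_pow, map_intCast]
    congr 1
    exact (aeval_algHom_apply (φ.restrictScalars ℤ) (v i) g).symm
  -- The integer `w` is nonzero modulo `p`, yet the assumed relation rewrites it as a sum of
  -- approximation errors, of norm below 1.
  set w : ℤ := a ^ (p * N) * n * m + p * z with hw
  have hpZ : Prime (p : ℤ) := Nat.prime_iff_prime_int.mp hprime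
  have hndvd : ∀ {t : ℤ}, t ≠ 0 → t.natAbs < p → ¬ (p : ℤ) ∣ t := fun {t} ht hlt h =>
    absurd (Int.natAbs_dvd_natAbs.mpr h)
      (Nat.not_dvd_of_pos_of_lt (Int.natAbs_pos.mpr ht) (by simpa using hlt))
  have hw0 : w ≠ 0 := by
    intro h
    have hd : (p : ℤ) ∣ a ^ (p * N) * n * m := ⟨-z, by linarith⟩
    rcases hpZ.dvd_or_dvd hd with hd | hd
    · rcases hpZ.dvd_or_dvd hd with hd | hd
      · exact hndvd ha0 (by omega) (hpZ.dvd_of_dvd_pow hd)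
      · exact hn hd
    · exact hndvd hm (by omega) hd
  have hw1 : (1 : ℝ) ≤ ‖(w : ℂ)‖ := by
    rw [Complex.norm_intCast]
    exact_mod_cast Int.one_le_abs hw0
  have hwC : (w : ℂ) = ∑ i ∈ T, -((a : ℂ) ^ (p * N) *
      (n • Complex.exp (φ (v i)) - p • aeval (φ (v i)) g)) := by
    have hm' : (m : ℂ) = -∑ i ∈ T, Complex.exp (φ (v i)) := by linear_combination hsum
    rw [hw]
    push_cast
    rw [hz', hm', mul_neg, Finset.mul_sum, Finset.mul_sum, ← Finset.sum_neg_distrib,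
      ← Finset.sum_add_distrib]
    refine Finset.sum_congr rfl fun i _ => ?_
    rw [zsmul_eq_mul, nsmul_eq_mul]
    ring
  have hw2 : ‖(w : ℂ)‖ ≤ T.card * ((|(a : ℝ)| ^ N * c) ^ p / ((p - 1).factorial : ℝ)) := by
    rw [hwC, ← nsmul_eq_mul]
    refine (norm_sum_le _ _).trans (Finset.sum_le_card_nsmul _ _ _ fun i hi => ?_)
    have hroot : φ (v i) ∈ G.aroots ℂ := by
      rw [mem_aroots]
      refine ⟨hGne, ?_⟩
      have := aeval_algHom_apply (φ.restrictScalars ℤ) (v i) G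
      rw [hGv i hi, map_zero] at this
      exact this
    rw [norm_neg, norm_mul, norm_pow, Complex.norm_intCast, mul_pow, ← pow_mul, mul_comm N p,
      mul_div_assoc]
    exact mul_le_mul_of_nonneg_left (hg hroot) (by positivity)
  exact absurd (hw1.trans hw2) (not_le.mpr (hp₀ p (by omega)))

open Polynomial in
/-- The product of `1 + exp β` over the conjugates `β` of `x` expands into a sum over subsets. -/
theorem not_isAlgebraic_of_exp_eq_neg_one {x : ℂ} (hx : Complex.exp x = -1) :
    ¬ IsAlgebraic ℚ x := by
  classical
  intro halg
  have : IsAlgClosure ℚ (algebraicClosure ℚ ℂ) := algebraicClosure.isAlgClosure ℚ ℂ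
  have : IsGalois ℚ (algebraicClosure ℚ ℂ) := IsAlgClosure.isGalois ℚ (algebraicClosure ℚ ℂ)
  set L := algebraicClosure ℚ ℂ
  let y : L := ⟨x, mem_algebraicClosure_iff.mpr halg⟩
  let φ : L →ₐ[ℚ] ℂ := L.val
  have hyint : IsIntegral ℚ y := Algebra.IsIntegral.isIntegral y
  set s : Finset L := ((minpoly ℚ y).aroots L).toFinset with hs
  have hmem : ∀ u : L, u ∈ s ↔ aeval u (minpoly ℚ y) = 0 := fun u => by
    rw [hs, Multiset.mem_toFinset, mem_aroots, and_iff_right (minpoly.ne_zero hyint)]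
  have hys : y ∈ s := (hmem y).mpr (minpoly.aeval ℚ y)
  have hmap : ∀ (σ : Gal(L/ℚ)) (u : L), u ∈ s ↔ σ u ∈ s := fun σ u => by
    have h : aeval (σ u) (minpoly ℚ y) = σ (aeval u (minpoly ℚ y)) :=
      aeval_algHom_apply (σ : L →ₐ[ℚ] L) u _
    rw [hmem, hmem, h, map_eq_zero_iff σ σ.injective]
  have hprod : ∏ u ∈ s, (Complex.exp (φ u) + 1) = 0 :=
    Finset.prod_eq_zero hys (by rw [show φ y = x from rfl, hx, neg_add_cancel])
  rw [Finset.prod_add_one] at hprod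
  have hexp : ∑ t ∈ s.powerset, Complex.exp (φ (∑ u ∈ t, u)) = 0 := by
    rw [← hprod]
    exact Finset.sum_congr rfl fun t _ => by rw [map_sum, Complex.exp_sum]
  rw [← Finset.sum_filter_add_sum_filter_not s.powerset (fun t => ∑ u ∈ t, u = 0)] at hexp
  have hzero : ∑ t ∈ s.powerset with ∑ u ∈ t, u = 0, Complex.exp (φ (∑ u ∈ t, u)) =
      (({t ∈ s.powerset | ∑ u ∈ t, u = 0}.card : ℤ) : ℂ) := by
    rw [Finset.sum_congr rfl fun t ht => by
      rw [(Finset.mem_filter.mp ht).2, map_zero, Complex.exp_zero]]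
    simp
  rw [hzero] at hexp
  refine add_sum_exp_ne_zero_of_galois_stable φ _ (fun t : Finset L => ∑ u ∈ t, u)
    (fun t ht => (Finset.mem_filter.mp ht).2) (fun σ => ?_) ?_ hexp
  · have hsum : ∀ t : Finset L, ∑ u ∈ t.map σ.toEquiv.toEmbedding, u = σ (∑ u ∈ t, u) :=
      fun t => by rw [Finset.sum_map, map_sum]; rfl
    refine ⟨σ.toEquiv.finsetCongr, fun t => ?_, fun t _ => (hsum t).symm⟩
    rw [Finset.mem_filter, Finset.mem_filter, Finset.mem_powerset, Finset.mem_powerset,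
      Equiv.finsetCongr_apply, hsum]
    refine and_congr ?_ (map_eq_zero_iff σ σ.injective).not.symm
    constructor
    · intro h u hu
      obtain ⟨w, hw, rfl⟩ := Finset.mem_map.mp hu
      exact (hmap σ w).mp (h hw)
    · intro h u hu
      exact (hmap σ u).mpr (h (Finset.mem_map_of_mem _ hu))
  -- The empty subset has sum zero, so the integer term is positive.
  · have : ∅ ∈ ({t ∈ s.powerset | ∑ u ∈ t, u = 0} : Finset (Finset L)) := by simp
    exact_mod_cast (Finset.card_pos.mpr ⟨_, this⟩).ne'

/-- Lindemann's theorem. -/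
theorem transcendental_pi : Transcendental ℚ (Real.pi : ℂ) := fun h =>
  not_isAlgebraic_of_exp_eq_neg_one Complex.exp_pi_mul_I
    (h.mul (IsIntegral.isAlgebraic (IsIntegral.of_pow two_pos
      (by rw [Complex.I_sq]; exact isIntegral_one.neg))))

/-! ### Conjugating `K`-linear relations between roots of unity. -/

open Polynomial in
/-- If `K ∩ ℚ(ζ_q) = ℚ`, then a `K`-linear relation between powers of `ζ_q` persists when `ζ_q` is
replaced by another primitive `q`-th root of unity. -/
theorem aeval_pow_eq_zero_of_inf_cyclotomicSubfield_eq_bot {q : ℕ} (hq : 0 < q)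
    {K : IntermediateField ℚ ℂ} (hK : K ⊓ Milnor.cyclotomicSubfield q = ⊥) {P : K[X]}
    (hP : aeval (Complex.exp (2 * Real.pi * Complex.I / q)) P = 0) {h : ℕ} (hh : h.Coprime q) :
    aeval (Complex.exp (2 * Real.pi * Complex.I / q) ^ h) P = 0 := by
  set ζ : ℂ := Complex.exp (2 * Real.pi * Complex.I / q) with hζdef
  have hζ : IsPrimitiveRoot ζ q := Complex.isPrimitiveRoot_exp q hq.ne'
  have hζmem : ζ ∈ Milnor.cyclotomicSubfield q :=
    IntermediateField.mem_adjoin_simple_self ℚ ζ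
  have hζint : IsIntegral K ζ := hζ.isIntegral hq |>.tower_top
  set m := minpoly K ζ with hm
  have hmX : m ∣ X ^ q - 1 := minpoly.dvd K ζ (by simp [hζ.pow_eq_one])
  -- All roots of `m` are powers of `ζ`, so its coefficients lie in `K ∩ ℚ(ζ_q) = ℚ`.
  have hroots : ∀ r ∈ (m.map (algebraMap K ℂ)).roots, r ∈ Milnor.cyclotomicSubfield q := by
    intro r hr
    have hr0 : aeval r m = 0 := by
      rw [aeval_def, ← eval_map]
      exact (mem_roots'.mp hr).2
    obtain ⟨t, ht⟩ := hmX
    have hrq : r ^ q = 1 := by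
      have := congrArg (aeval r) ht
      rw [map_mul, hr0, zero_mul] at this
      simpa [sub_eq_zero] using this
    have : NeZero q := ⟨hq.ne'⟩
    obtain ⟨i, -, rfl⟩ := hζ.eq_pow_of_pow_eq_one hrq
    exact pow_mem hζmem i
  have hlift : m.map (algebraMap K ℂ) ∈
      lifts (algebraMap (Milnor.cyclotomicSubfield q) ℂ) := by
    rw [(IsAlgClosed.splits (m.map (algebraMap K ℂ))).eq_prod_roots_of_monic
      ((minpoly.monic hζint).map _)]
    refine Subsemiring.multiset_prod_mem _ _ fun f hf => ?_
    obtain ⟨r, hr, rfl⟩ := Multiset.mem_map.mp hf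
    exact (mem_lifts _).mpr ⟨X - C ⟨r, hroots r hr⟩, by simp⟩
  have hlift' : m ∈ lifts (algebraMap ℚ K) := by
    rw [lifts_iff_coeff_lifts] at hlift ⊢
    intro n
    obtain ⟨c, hc⟩ := hlift n
    rw [coeff_map] at hc
    have hmem : (m.coeff n : ℂ) ∈ K ⊓ Milnor.cyclotomicSubfield q :=
      ⟨(m.coeff n).2, (show (c : ℂ) = m.coeff n from hc) ▸ c.2⟩
    rw [hK, IntermediateField.mem_bot] at hmem
    obtain ⟨r, hr⟩ := hmem
    exact ⟨r, Subtype.ext hr⟩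
  obtain ⟨m₀, hm₀⟩ := (mem_lifts _).mp hlift'
  have hm₀ζ : aeval ζ m₀ = 0 := by
    rw [← aeval_map_algebraMap K, hm₀]
    exact minpoly.aeval K ζ
  have hdvd : minpoly ℚ (ζ ^ h) ∣ m₀ := by
    rw [← cyclotomic_eq_minpoly_rat (hζ.pow_of_coprime h hh) hq, cyclotomic_eq_minpoly_rat hζ hq]
    exact minpoly.dvd ℚ ζ hm₀ζ
  have hm0 : aeval (ζ ^ h) m = 0 := by
    rw [← hm₀, aeval_map_algebraMap]
    exact aeval_eq_zero_of_dvd_aeval_eq_zero hdvd (minpoly.aeval ℚ _)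
  exact aeval_eq_zero_of_dvd_aeval_eq_zero (minpoly.dvd K ζ hP) hm0

/-! ### Bernoulli–Fourier sums and Hurwitz zeta values. -/

/-- The sum over `j` of Bernoulli polynomial values against the discrete Fourier transform of `F`,
which is `∑ n, F n / n ^ k` up to an explicit multiple of `π ^ k`. -/
noncomputable def bernoulliFourierSum {q : ℕ} [NeZero q] (k : ℕ) (F : ZMod q → ℂ) : ℂ :=
  ∑ j : ZMod q, ∑ a : ZMod q,
    (((Polynomial.bernoulli k).eval ((j.val : ℚ) / q) : ℚ) : ℂ) * F a * ZMod.stdAddChar (-(a * j))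

theorem fourier_val_div_eq_stdAddChar {q : ℕ} [NeZero q] (n : ℤ) (j : ZMod q) :
    fourier n (((j.val : ℝ) / q : ℝ) : UnitAddCircle) = ZMod.stdAddChar ((n : ZMod q) * j) := by
  have h : (n : ZMod q) * j = ((n * (j.val : ℤ) : ℤ) : ZMod q) := by simp
  rw [fourier_coe_apply, h, ZMod.stdAddChar_coe]
  congr 1
  push_cast
  ring

/-- The Fourier expansion of the Bernoulli polynomial at `j/q` is weighted by the transform of `F`
and summed over `j`. Fourier inversion turns the `n`-th term into `q (F n + (-1)^k F(-n)) / n^k`,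
and parity makes this `2q F n / n^k`. -/
theorem hasSum_div_pow_bernoulliFourierSum {q : ℕ} [NeZero q] {k : ℕ} (hk : 2 ≤ k)
    {F : ZMod q → ℂ} (hF : ∀ a, F (-a) = (-1) ^ k * F a) :
    HasSum (fun n : ℕ => F n / (n : ℂ) ^ k)
      (-(2 * Real.pi * Complex.I) ^ k / k.factorial / (2 * q) * bernoulliFourierSum k F) := by
  have hq : (q : ℂ) ≠ 0 := Nat.cast_ne_zero.mpr (NeZero.ne q)
  have hdft : ∀ x : ZMod q, ∑ j : ZMod q, ZMod.stdAddChar (x * j) * ZMod.dft F j = q * F x := by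
    intro x
    have h := congrFun (ZMod.dft_dft F) (-x)
    rw [ZMod.dft_apply, neg_neg] at h
    simp only [smul_eq_mul] at h
    rw [← nsmul_eq_mul, ← Nat.cast_smul_eq_nsmul ℂ, smul_eq_mul]
    simpa [mul_comm x] using h
  have hterm : ∀ j : ZMod q, HasSum (fun n : ℕ => 1 / (n : ℂ) ^ k *
      (ZMod.stdAddChar ((n : ZMod q) * j) + (-1) ^ k * ZMod.stdAddChar (-(n : ZMod q) * j)) *
        ZMod.dft F j)
      (-(2 * Real.pi * Complex.I) ^ k / k.factorial *
        (((Polynomial.bernoulli k).eval ((j.val : ℚ) / q) : ℚ) : ℂ) * ZMod.dft F j) := by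
    intro j
    have hmem : ((j.val : ℝ) / q) ∈ Set.Icc (0 : ℝ) 1 :=
      ⟨by positivity, div_le_one_of_le₀ (by exact_mod_cast (ZMod.val_lt j).le) (by positivity)⟩
    have h := (hasSum_one_div_nat_pow_mul_fourier hk hmem).mul_right (ZMod.dft F j)
    have hB : ((bernoulliFun k ((j.val : ℝ) / q) : ℝ) : ℂ) =
        (((Polynomial.bernoulli k).eval ((j.val : ℚ) / q) : ℚ) : ℂ) := by
      have h1 : ((j.val : ℝ) / q) = algebraMap ℚ ℝ ((j.val : ℚ) / q) := by
        rw [map_div₀, map_natCast, map_natCast]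
      rw [bernoulliFun, h1, Polynomial.eval_map_apply]
      simp
    rw [hB] at h
    simpa only [fourier_val_div_eq_stdAddChar, Int.cast_neg, Int.cast_natCast] using h
  have hsum := hasSum_sum (s := Finset.univ) fun j _ => hterm j
  have h2 := hsum.mul_left (1 / (2 * q : ℂ))
  convert! h2 using 1
  · funext n
    have e1 : ∑ j : ZMod q, 1 / (n : ℂ) ^ k *
        (ZMod.stdAddChar ((n : ZMod q) * j) + (-1) ^ k * ZMod.stdAddChar (-(n : ZMod q) * j)) *
          ZMod.dft F j = 1 / (n : ℂ) ^ k * (q * F n + (-1) ^ k * (q * F (-n))) := by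
      rw [← hdft, ← hdft, Finset.mul_sum, ← Finset.sum_add_distrib, Finset.mul_sum]
      exact Finset.sum_congr rfl fun j _ => by ring
    have hsq : ((-1 : ℂ) ^ k) * (-1) ^ k = 1 := by rw [← mul_pow]; simp
    have e2 : 1 / (n : ℂ) ^ k * (q * F n + (-1) ^ k * (q * ((-1) ^ k * F n))) =
        2 * q * (F n / (n : ℂ) ^ k) := by
      linear_combination (q * F n / (n : ℂ) ^ k) * hsq
    rw [e1, hF, e2]
    field_simp
  · rw [bernoulliFourierSum, Finset.mul_sum, Finset.mul_sum]
    refine Finset.sum_congr rfl fun j _ => ?_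
    rw [ZMod.dft_apply, Finset.mul_sum, Finset.mul_sum, Finset.mul_sum]
    refine Finset.sum_congr rfl fun a _ => ?_
    rw [smul_eq_mul]
    ring

/-- A bounded Dirichlet series at an exponent at least `2` whose first coefficient dominates all
others vanishes only if that coefficient does. -/
theorem eq_zero_of_hasSum_div_pow_eq_zero {q : ℕ} {k : ℕ} (hk : 2 ≤ k) {F : ZMod q → ℂ}
    (hmax : ∀ a, ‖F a‖ ≤ ‖F 1‖) (hsum : HasSum (fun n : ℕ => F n / (n : ℂ) ^ k) 0) :
    F 1 = 0 := by
  have h1 := hsum.sub (hasSum_ite_eq (1 : ℕ) (F 1))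
  have h2 := (hasSum_zeta_two.sub (hasSum_ite_eq (1 : ℕ) (1 : ℝ))).mul_left ‖F 1‖
  have hle := h1.norm_le_of_bounded h2 fun n => by
    rcases Nat.lt_trichotomy n 1 with hn | rfl | hn
    · obtain rfl : n = 0 := by omega
      simp [show k ≠ 0 by omega]
    · simp
    · rw [if_neg hn.ne', if_neg hn.ne', sub_zero, sub_zero, norm_div, norm_pow,
        Complex.norm_natCast, ← mul_one_div]
      have hn1 : (1 : ℝ) ≤ n := by exact_mod_cast hn.le
      gcongr
      · exact hmax _
  rw [zero_sub, norm_neg] at hle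
  by_contra hne
  have hpos : 0 < ‖F 1‖ := norm_pos_iff.mpr hne
  have hpi : Real.pi ^ 2 / 6 - 1 < 1 := by nlinarith [Real.pi_lt_d2, Real.pi_pos]
  exact absurd hle (not_le.mpr (mul_lt_of_lt_one_right hpos hpi))

theorem sum_mul_zetaValue_eq {q : ℕ} [NeZero q] {k : ℕ} (hk : 2 ≤ k) {F : ZMod q → ℂ}
    (hF : ∀ a, F (-a) = (-1) ^ k * F a) :
    ∑ a : ZMod q, F a * Milnor.zetaValue k q a.val =
      (q : ℂ) ^ k * (-(2 * Real.pi * Complex.I) ^ k / k.factorial / (2 * q) *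
        bernoulliFourierSum k F) := by
  have hq : (q : ℂ) ≠ 0 := Nat.cast_ne_zero.mpr (NeZero.ne q)
  have hL := ZMod.LFunction_eq_LSeries F (s := k) (by
    rw [Complex.natCast_re]; exact_mod_cast hk)
  have hS : LSeries (fun n => F n) k =
      -(2 * Real.pi * Complex.I) ^ k / k.factorial / (2 * q) * bernoulliFourierSum k F := by
    rw [← (hasSum_div_pow_bernoulliFourierSum hk hF).tsum_eq, LSeries]
    refine tsum_congr fun n => ?_
    rcases eq_or_ne n 0 with rfl | hn
    · simp [show k ≠ 0 by omega]
    · rw [LSeries.term_of_ne_zero hn, Complex.cpow_natCast]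
  rw [← hS, ← hL, ZMod.LFunction, Complex.cpow_neg, Complex.cpow_natCast,
    mul_inv_cancel_left₀ (pow_ne_zero k hq)]
  refine Finset.sum_congr rfl fun a _ => ?_
  rw [Milnor.zetaValue, ZMod.toAddCircle_apply]

open Polynomial in
/-- The Bernoulli–Fourier sum of a `K`-valued function as the value at `ζ_q` of a polynomial over
`K`; evaluating at `ζ_q ^ h` instead amounts to rescaling the argument of the function. -/
noncomputable def bernoulliFourierPoly {q : ℕ} [NeZero q] (k : ℕ) {K : IntermediateField ℚ ℂ}
    (f : ZMod q → K) : K[X] :=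
  ∑ j : ZMod q, ∑ a : ZMod q,
    C (algebraMap ℚ K ((Polynomial.bernoulli k).eval ((j.val : ℚ) / q)) * f a) *
      X ^ (-(a * j)).val

theorem stdAddChar_eq_exp_pow_val {q : ℕ} [NeZero q] (x : ZMod q) :
    ZMod.stdAddChar x = Complex.exp (2 * Real.pi * Complex.I / q) ^ x.val := by
  rw [← Complex.exp_nat_mul]
  have h := ZMod.stdAddChar_coe (N := q) (x.val : ℤ)
  rw [Int.cast_natCast, ZMod.natCast_zmod_val] at h
  rw [h]
  congr 1
  push_cast
  ring

open Polynomial in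
-- Substituting `u * a` for `a` cancels `u⁻¹` in the exponent, while the Bernoulli values depend
-- only on `j` and stay put.
theorem aeval_bernoulliFourierPoly {q : ℕ} [NeZero q] (k : ℕ) {K : IntermediateField ℚ ℂ}
    (f : ZMod q → K) (u : (ZMod q)ˣ) :
    aeval (Complex.exp (2 * Real.pi * Complex.I / q) ^ (u⁻¹ : (ZMod q)ˣ).val.val)
      (bernoulliFourierPoly k f) = bernoulliFourierSum k fun a => (f ((u : ZMod q) * a) : ℂ) := by
  rw [bernoulliFourierPoly, bernoulliFourierSum, map_sum]
  refine Finset.sum_congr rfl fun j _ => ?_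
  rw [map_sum]
  refine (Fintype.sum_equiv (Units.mulLeft u) _ _ fun a => ?_).symm
  rw [map_mul, map_pow, aeval_X, aeval_C, map_mul, ← pow_mul, mul_comm (ZMod.val _), pow_mul,
    ← stdAddChar_eq_exp_pow_val, ← AddChar.map_nsmul_eq_pow, nsmul_eq_mul,
    ZMod.natCast_zmod_val, Units.mulLeft_apply]
  have h : (u⁻¹ : (ZMod q)ˣ).val * -((u : ZMod q) * a * j) = -(a * j) := by
    linear_combination (-(a * j)) * u.inv_mul
  rw [h, ← IsScalarTower.algebraMap_apply ℚ K ℂ]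
  simp [IntermediateField.algebraMap_apply]

open Polynomial in
theorem aeval_exp_bernoulliFourierPoly {q : ℕ} [NeZero q] (k : ℕ) {K : IntermediateField ℚ ℂ}
    (f : ZMod q → K) (hq : 1 < q) :
    aeval (Complex.exp (2 * Real.pi * Complex.I / q)) (bernoulliFourierPoly k f) =
      bernoulliFourierSum k fun a => (f a : ℂ) := by
  have : Fact (1 < q) := ⟨hq⟩
  simpa [ZMod.val_one] using aeval_bernoulliFourierPoly k f 1

theorem isAlgebraic_bernoulliFourierSum {q : ℕ} [NeZero q] (k : ℕ) {F : ZMod q → ℂ}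
    (hF : ∀ a, IsAlgebraic ℚ (F a)) : IsAlgebraic ℚ (bernoulliFourierSum k F) := by
  rw [bernoulliFourierSum, ← mem_algebraicClosure_iff]
  refine sum_mem fun j _ => sum_mem fun a _ => mul_mem (mul_mem ?_ ?_) ?_
  · exact algebraMap_mem (algebraicClosure ℚ ℂ) (_ : ℚ)
  · exact mem_algebraicClosure_iff.mpr (hF a)
  · rw [stdAddChar_eq_exp_pow_val]
    exact pow_mem (mem_algebraicClosure_iff.mpr
      ((Complex.isPrimitiveRoot_exp q (NeZero.ne q)).isIntegral (NeZero.pos q)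
        |>.tower_top (A := ℚ)).isAlgebraic) _

/-- Nonvanishing of `∑ n, f n / n ^ k` for `K`-valued `f` of the right parity supported on units:
conjugating moves the largest value of `f` to the first coefficient. -/
theorem eq_zero_of_bernoulliFourierSum_eq_zero {k q : ℕ} [NeZero q] (hk : 2 ≤ k) (hq : 1 < q)
    {K : IntermediateField ℚ ℂ} (hK : K ⊓ Milnor.cyclotomicSubfield q = ⊥) {f : ZMod q → K}
    (hunit : ∀ a, f a ≠ 0 → IsUnit a) (hpar : ∀ a, f (-a) = (-1) ^ k * f a)
    (hsum : bernoulliFourierSum k (fun a => (f a : ℂ)) = 0) : f = 0 := by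
  obtain ⟨a₀, ha₀⟩ := Finite.exists_max fun a => ‖(f a : ℂ)‖
  by_cases h0 : f a₀ = 0
  · funext a
    have h := ha₀ a
    rw [h0, ZeroMemClass.coe_zero, norm_zero, norm_le_zero_iff] at h
    exact Subtype.ext h
  obtain ⟨u, rfl⟩ := hunit a₀ h0
  refine absurd ?_ h0
  rw [← aeval_exp_bernoulliFourierPoly k f hq] at hsum
  have h1 := aeval_pow_eq_zero_of_inf_cyclotomicSubfield_eq_bot (NeZero.pos q) hK hsum
    (ZMod.val_coe_unit_coprime u⁻¹)
  rw [aeval_bernoulliFourierPoly] at h1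
  set F : ZMod q → ℂ := fun a => (f ((u : ZMod q) * a) : ℂ) with hFdef
  have hF1 : F 1 = f u := by rw [hFdef]; exact congrArg (fun x => (f x : ℂ)) (mul_one _)
  have hpar' : ∀ a, F (-a) = (-1) ^ k * F a := fun a => by
    rw [hFdef]
    simp only [mul_neg, hpar]
    push_cast
    rfl
  have hmax : ∀ a, ‖F a‖ ≤ ‖F 1‖ := fun a => by
    rw [hF1]
    exact ha₀ _
  have h2 := hasSum_div_pow_bernoulliFourierSum hk hpar'
  rw [h1, mul_zero] at h2
  have h3 := eq_zero_of_hasSum_div_pow_eq_zero hk hmax h2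
  rw [hF1] at h3
  exact Subtype.ext h3

/-- The Hurwitz zeta values of the right parity are linearly independent together with `1`. -/
theorem eq_zero_of_add_sum_mul_zetaValue_eq_zero {k q : ℕ} [NeZero q] (hk : 2 ≤ k) (hq : 1 < q)
    {K : IntermediateField ℚ ℂ} [NumberField K] (hK : K ⊓ Milnor.cyclotomicSubfield q = ⊥)
    {f : ZMod q → K} (hunit : ∀ a, f a ≠ 0 → IsUnit a) (hpar : ∀ a, f (-a) = (-1) ^ k * f a)
    {c : K} (hsum : (c : ℂ) + ∑ a, (f a : ℂ) * Milnor.zetaValue k q a.val = 0) :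
    c = 0 ∧ f = 0 := by
  have halg : ∀ x : K, IsAlgebraic ℚ (x : ℂ) := fun x =>
    (Algebra.IsAlgebraic.isAlgebraic x).algebraMap
  have hz := sum_mul_zetaValue_eq hk (F := fun a => (f a : ℂ)) fun a => by
    rw [hpar]
    push_cast
    rfl
  set S := bernoulliFourierSum k fun a => (f a : ℂ) with hS
  -- Otherwise the relation could be solved for `π ^ k` in terms of algebraic numbers.
  have hS0 : S = 0 := by
    by_contra hne
    have hSalg : IsAlgebraic ℚ S := isAlgebraic_bernoulliFourierSum k fun a => halg (f a)
    have hI : IsAlgebraic ℚ Complex.I := (IsIntegral.of_pow two_pos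
      (by rw [Complex.I_sq]; exact isIntegral_one.neg)).isAlgebraic
    have hqC : (q : ℂ) ≠ 0 := Nat.cast_ne_zero.mpr (NeZero.ne q)
    have hfac : (k.factorial : ℂ) ≠ 0 := Nat.cast_ne_zero.mpr k.factorial_ne_zero
    have hD : (q : ℂ) ^ k * (2 * Complex.I) ^ k * S ≠ 0 :=
      mul_ne_zero (mul_ne_zero (pow_ne_zero _ hqC)
        (pow_ne_zero _ (mul_ne_zero two_ne_zero Complex.I_ne_zero))) hne
    have hpi : (Real.pi : ℂ) ^ k =
        (c * (k.factorial * (2 * q) : ℕ)) / ((q : ℂ) ^ k * (2 * Complex.I) ^ k * S) := by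
      rw [eq_div_iff hD]
      rw [hz] at hsum
      have hc : (c : ℂ) =
          (q : ℂ) ^ k * ((2 * Real.pi * Complex.I) ^ k / k.factorial / (2 * q) * S) := by
        linear_combination hsum
      rw [hc]
      push_cast
      rw [mul_pow, mul_pow, mul_pow]
      field_simp
    refine transcendental_pi (IsAlgebraic.of_pow (n := k) (by omega) ?_)
    rw [hpi, div_eq_mul_inv]
    exact ((halg c).mul (isAlgebraic_natCast _)).mul
      ((((isAlgebraic_natCast q).pow k).mul (((isAlgebraic_natCast 2).mul hI).pow k)).mul hSalg).inv
  have hf := eq_zero_of_bernoulliFourierSum_eq_zero hk hq hK hunit hpar hS0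
  rw [hz, hS0] at hsum
  exact ⟨by simpa using hsum, hf⟩

/-! ### Counting residues up to sign and the dimension bound. -/

/-- Representatives of the reduced residues modulo `q` up to sign. -/
def halfReducedResidues (q : ℕ) : Finset ℕ := {a ∈ Finset.range q | a.Coprime q ∧ 2 * a < q}

theorem totient_le_two_mul_card_halfReducedResidues {q : ℕ} (hq : 2 < q) :
    q.totient ≤ 2 * (halfReducedResidues q).card := by
  have hsub : {a ∈ Finset.range q | q.Coprime a} ⊆
      halfReducedResidues q ∪ (halfReducedResidues q).image (q - ·) := by
    intro a ha
    rw [Finset.mem_filter, Finset.mem_range] at ha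
    obtain ⟨haq, hcop⟩ := ha
    rw [Finset.mem_union, Finset.mem_image]
    rcases Nat.lt_trichotomy (2 * a) q with h | h | h
    · exact Or.inl (Finset.mem_filter.mpr ⟨Finset.mem_range.mpr haq, hcop.symm, h⟩)
    -- Here `q = 2a` and coprimality force `a = 1`, contradicting `q > 2`.
    · have h1 : a ∣ 1 := hcop ▸ Nat.dvd_gcd ⟨2, by omega⟩ dvd_rfl
      have := Nat.dvd_one.mp h1
      omega
    · refine Or.inr ⟨q - a, ?_, by omega⟩
      rw [halfReducedResidues, Finset.mem_filter, Finset.mem_range]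
      have ha0 : a ≠ 0 := by omega
      refine ⟨by omega, ?_, by omega⟩
      exact (Nat.coprime_self_sub_left haq.le).mpr hcop.symm
  rw [Nat.totient]
  refine (Finset.card_le_card hsub).trans ((Finset.card_union_le _ _).trans ?_)
  have := Finset.card_image_le (s := halfReducedResidues q) (f := (q - ·))
  omega

/-- `1` together with the Hurwitz zeta values, symmetrized with the parity of `k`. -/
noncomputable def symmetrizedZetaValue (k q : ℕ) : Option (halfReducedResidues q) → ℂ
  | none => 1
  | some a => Milnor.zetaValue k q ((a.1 : ZMod q)).val +
      (-1) ^ k * Milnor.zetaValue k q (-(a.1 : ZMod q)).val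

theorem linearIndependent_symmetrizedZetaValue {k q : ℕ} (hk : 1 < k) (hq : 2 < q)
    {K : IntermediateField ℚ ℂ} [NumberField K] (hK : K ⊓ Milnor.cyclotomicSubfield q = ⊥) :
    LinearIndependent K (symmetrizedZetaValue k q) := by
  have : NeZero q := ⟨by omega⟩
  rw [Fintype.linearIndependent_iff]
  intro g hg
  rw [Fintype.sum_option] at hg
  have hH : ∀ a : halfReducedResidues q, a.1.Coprime q ∧ 2 * a.1 < q := fun a =>
    (Finset.mem_filter.mp a.2).2
  have hHpos : ∀ a : halfReducedResidues q, a.1 ≠ 0 := fun a h0 => by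
    have := (hH a).1
    rw [h0, Nat.coprime_zero_left] at this
    omega
  -- The coefficients are spread over all residues with parity `(-1)^k`, so that the relation takes
  -- the form treated above.
  let f : ZMod q → K := fun x => ∑ a : halfReducedResidues q, g (some a) *
    ((if x = (a.1 : ZMod q) then 1 else 0) + (-1) ^ k * (if x = -(a.1 : ZMod q) then 1 else 0))
  have hf : ∀ a, f (a.1 : ℕ) = g (some a) := by
    intro b
    have hbq : ∀ a : halfReducedResidues q, (b.1 : ZMod q) = (a.1 : ZMod q) ↔ b = a := by
      intro a
      rw [ZMod.natCast_eq_natCast_iff', Nat.mod_eq_of_lt, Nat.mod_eq_of_lt, Subtype.ext_iff]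
      · have := (hH a).2; omega
      · have := (hH b).2; omega
    -- Two representatives have sum strictly between 0 and `q`.
    have hneg : ∀ a : halfReducedResidues q, ¬ (b.1 : ZMod q) = -(a.1 : ZMod q) := by
      intro a h
      rw [eq_neg_iff_add_eq_zero, ← Nat.cast_add, ZMod.natCast_eq_zero_iff] at h
      have := Nat.le_of_dvd (by have := hHpos a; omega) h
      have := (hH a).2
      have := (hH b).2
      omega
    simp only [f, hbq, hneg, if_false, mul_zero, add_zero, mul_ite, mul_one]
    rw [Finset.sum_ite_eq]
    simp
  have hunit : ∀ x, f x ≠ 0 → IsUnit x := by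
    intro x hx
    obtain ⟨a, -, ha⟩ := Finset.exists_ne_zero_of_sum_ne_zero hx
    have hua : IsUnit (a.1 : ZMod q) := (ZMod.isUnit_iff_coprime a.1 q).mpr (hH a).1
    by_cases h1 : x = (a.1 : ZMod q)
    · rwa [h1]
    by_cases h2 : x = -(a.1 : ZMod q)
    · rw [h2]
      exact hua.neg
    · simp [h1, h2] at ha
  have hsq : ((-1 : K) ^ k) * (-1) ^ k = 1 := by rw [← mul_pow]; simp
  have hpar : ∀ x, f (-x) = (-1) ^ k * f x := by
    intro x
    simp only [f, Finset.mul_sum, neg_eq_iff_eq_neg, neg_neg]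
    refine Finset.sum_congr rfl fun a _ => ?_
    linear_combination (-g (some a) * (if x = -(a.1 : ZMod q) then 1 else 0)) * hsq
  have hsum : ((g none : K) : ℂ) + ∑ x, (f x : ℂ) * Milnor.zetaValue k q x.val = 0 := by
    rw [← hg]
    congr 1
    · simp [symmetrizedZetaValue, Algebra.smul_def, IntermediateField.algebraMap_apply]
    · simp only [f, AddSubmonoidClass.coe_finsetSum, Finset.sum_mul]
      rw [Finset.sum_comm]
      refine Finset.sum_congr rfl fun a _ => ?_
      simp only [symmetrizedZetaValue, Algebra.smul_def, IntermediateField.algebraMap_apply]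
      have hx : ∀ x : ZMod q, ((g (some a) * ((if x = (a.1 : ZMod q) then 1 else 0) +
          (-1) ^ k * (if x = -(a.1 : ZMod q) then 1 else 0)) : K) : ℂ) *
            Milnor.zetaValue k q x.val = (g (some a) : ℂ) *
          ((if x = (a.1 : ZMod q) then Milnor.zetaValue k q x.val else 0) +
            (-1) ^ k * (if x = -(a.1 : ZMod q) then Milnor.zetaValue k q x.val else 0)) := by
        intro x
        push_cast
        split_ifs <;> simp <;> ring
      rw [Finset.sum_congr rfl fun x _ => hx x, ← Finset.mul_sum, Finset.sum_add_distrib,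
        ← Finset.mul_sum, Finset.sum_ite_eq', Finset.sum_ite_eq']
      simp
  obtain ⟨hc, hf0⟩ := eq_zero_of_add_sum_mul_zetaValue_eq_zero hk (by omega) hK hunit hpar hsum
  rintro (_ | a)
  · exact hc
  · rw [← hf a, hf0, Pi.zero_apply]

theorem zetaValue_val_mem_extendedSpace {k q : ℕ} [NeZero q] (hq : 1 < q)
    (K : IntermediateField ℚ ℂ) {x : ZMod q} (hx : IsUnit x) :
    Milnor.zetaValue k q x.val ∈ Milnor.extendedSpace k q K := by
  obtain ⟨u, rfl⟩ := hx
  have hcop := ZMod.val_coe_unit_coprime u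
  refine Submodule.subset_span (Set.mem_insert_of_mem _ ⟨_, ?_, ZMod.val_lt _, hcop, rfl⟩)
  refine Nat.one_le_iff_ne_zero.mpr fun h0 => ?_
  rw [h0, Nat.coprime_zero_left] at hcop
  omega

/-- `finrank` is 0 on infinite-dimensional spaces, so its monotonicity needs this. -/
theorem finiteDimensional_extendedSpace (k q : ℕ) (K : IntermediateField ℚ ℂ) :
    FiniteDimensional K (Milnor.extendedSpace k q K) := by
  refine FiniteDimensional.span_of_finite K (Set.Finite.insert _ ?_)
  refine ((Set.finite_Iio q).image (Milnor.zetaValue k q)).subset ?_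
  rintro z ⟨a, -, haq, -, rfl⟩
  exact ⟨a, haq, rfl⟩

theorem theorem3p3 (k q : ℕ) (hk : 1 < k) (hq : 2 < q)
    (K : IntermediateField ℚ ℂ) [NumberField K]
    (hK : K ⊓ Milnor.cyclotomicSubfield q = ⊥) :
    (Nat.totient q : ℚ) / 2 + 1 ≤ (Module.finrank K (Milnor.extendedSpace k q K) : ℚ) := by
  have : NeZero q := ⟨by omega⟩
  have := finiteDimensional_extendedSpace k q K
  have hle : Submodule.span K (Set.range (symmetrizedZetaValue k q)) ≤
      Milnor.extendedSpace k q K := by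
    rw [Submodule.span_le]
    rintro _ ⟨_ | a, rfl⟩
    · exact Submodule.subset_span (Set.mem_insert _ _)
    · have hua : IsUnit (a.1 : ZMod q) :=
        (ZMod.isUnit_iff_coprime a.1 q).mpr (Finset.mem_filter.mp a.2).2.1
      refine add_mem (zetaValue_val_mem_extendedSpace (by omega) K hua) ?_
      have := Submodule.smul_mem _ ((-1 : K) ^ k)
        (zetaValue_val_mem_extendedSpace (k := k) (by omega) K hua.neg)
      simpa [Algebra.smul_def] using this
  have hrank := Submodule.finrank_mono hle
  rw [finrank_span_eq_card (linearIndependent_symmetrizedZetaValue hk hq hK), Fintype.card_option,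
    Fintype.card_coe] at hrank
  have htot := totient_le_two_mul_card_halfReducedResidues hq
  have h1 : (q.totient : ℚ) ≤ 2 * (halfReducedResidues q).card := by exact_mod_cast htot
  have h2 : ((halfReducedResidues q).card : ℚ) + 1 ≤
      Module.finrank K (Milnor.extendedSpace k q K) := by exact_mod_cast hrank
  linarith
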